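/- Let $r\ge 1$. The purely discrete two-dimensional Toda lattice is the system $$\exp\bigl(u_{n+1,m+1}(j)+u_{n,m}(j)-u_{n+1,m}(j)-u_{n,m+1}(j)\bigr)=1+\exp\bigl(u_{n,m+1}(j-1)-u_{n,m+1}(j)-u_{n+1,m}(j)+u_{n+1,m}(j+1)\bigr)$$ for real-valued functions $u_{n,m}(j)$, $n,m,j\in\mathbb Z$; put $q_{n,m}(j)=u_{n,m}(j)-u_{n,m}(j-1)$ and $h_{n,m}(j)=\exp(q_{n+1,m-1}(j+1)-q_{n,m}(j))$. The $A$-series lattice of double length consists of the equations with $-r<j<r$ and the trivial boundary conditions $u(-r)=u(r)=0$. The $C$-series lattice of length $r$ is its reduction by the reflection $u_{n,m}(-j)=u_{n+j,m-j}(j)$, which induces the involution $h_{n,m}(-j)=h_{n+j,m-j}(j)$ of the Laplace invariants. Thus it is the system for the $r$ unknowns $\mathbf u_{n,m}=(u_{n,m}(0),\dots,u_{n,m}(r-1))$ that consists of the above equations with $j=0,1,\dots,r-1$, where $u_{n,m}(r)=0$ and $u_{n,m}(-1)=u_{n+1,m-1}(1)$. An $m$-integral of order $d$ is a smooth real function $J(\mathbf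 u_{n,m},\mathbf u_{n+1,m},\dots,\mathbf u_{n+d,m})$, depending on both $\mathbf u_{n,m}$ and $\mathbf u_{n+d,m}$, whose value does not change under the shift $m\mapsto m+1$ by virtue of the lattice equations. An $n$-integral of order $d$ is, likewise, a smooth real function $I(\mathbf u_{n,m},\mathbf u_{n,m+1},\dots,\mathbf u_{n,m+d})$, depending on both $\mathbf u_{n,m}$ and $\mathbf u_{n,m+d}$, whose value does not change under the shift $n\mapsto n+1$ by virtue of the lattice equations. A family $J_1,\dots,J_k$ of $m$-integrals of orders $d_1,\dots,d_k$ is essentially independent if the $k\times r$ matrix $\bigl(\partial J_a/\partial u_{n+d_a,m}(j)\bigr)_{a,j}$ has rank $k$ (at every point); for $n$-integrals one uses the matrix $\bigl(\partial I_a/\partial u_{n,m+d_a}(j)\bigr)_{a,j}$. Then, for every $r\ge1$, the purely discrete two-dimensional $C$-series Toda lattice of length $r$ is Darboux integrable: it admits an essentially independent family of $r$ $n$-integrals and an essentially independent family of $r$ $m$-integrals. -/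

import Mathlib

open scoped ContDiff

namespace Toda

/-! ### The purely discrete two-dimensional Toda lattice

A field of the lattice is a function `u : ℤ → ℤ → ℤ → ℝ`, where `u n m j` stands for
`u_{n,m}(j)`. -/

/-- The Laplace invariant `h_{n,m}(j) = exp (q_{n+1,m-1}(j+1) - q_{n,m}(j))`, where
`q_{n,m}(j) = u_{n,m}(j) - u_{n,m}(j-1)`. -/
noncomputable def laplaceInv (u : ℤ → ℤ → ℤ → ℝ) (n m j : ℤ) : ℝ :=
  Real.exp ((u (n + 1) (m - 1) (j + 1) - u (n + 1) (m - 1) j) - (u n m j - u n m (j - 1)))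

/-- The equation of the purely discrete Toda lattice with number `j` at the point `(n, m)`. -/
def EquationAt (u : ℤ → ℤ → ℤ → ℝ) (n m j : ℤ) : Prop :=
  Real.exp (u (n + 1) (m + 1) j + u n m j - u (n + 1) m j - u n (m + 1) j) =
    1 + Real.exp (u n (m + 1) (j - 1) - u n (m + 1) j - u (n + 1) m j + u (n + 1) m (j + 1))

/-- `u` solves the `A`-series lattice with `2r - 1` equations, `-r < j < r`, and the trivial
boundary conditions `u(-r) = u(r) = 0`. -/
def IsASeriesSolution (r : ℕ) (u : ℤ → ℤ → ℤ → ℝ) : Prop :=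
  (∀ n m, u n m (-r) = 0 ∧ u n m r = 0) ∧
    ∀ n m j : ℤ, -(r : ℤ) < j → j < r → EquationAt u n m j

/-! ### Reduction to the series `C`

The dynamic variables are `u(0), …, u(r-1)`; the others are restored by the reflection
`u_{n,m}(-j) = u_{n+j,m-j}(j)` and by `u(j) = 0` for `|j| ≥ r`. -/

/-- Extension of `u(0), …, u(r-1)` to all `j ∈ ℤ`. -/
def cExtend {r : ℕ} (u : ℤ → ℤ → Fin r → ℝ) (n m j : ℤ) : ℝ :=
  if h : j.natAbs < r then u (n + max (-j) 0) (m - max (-j) 0) ⟨j.natAbs, h⟩ else 0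

theorem cExtend_neg {r : ℕ} (u : ℤ → ℤ → Fin r → ℝ) (n m j : ℤ) :
    cExtend u n m (-j) = cExtend u (n + j) (m - j) j := by
  unfold cExtend
  have h1 : n + max (- -j) 0 = n + j + max (-j) 0 := by omega
  have h2 : m - max (- -j) 0 = m - j - max (-j) 0 := by omega
  simp only [Int.natAbs_neg, h1, h2]

/-- The extension satisfies the involution `h_{n,m}(-j) = h_{n+j,m-j}(j)`. -/
theorem laplaceInv_cExtend_neg {r : ℕ} (u : ℤ → ℤ → Fin r → ℝ) (n m j : ℤ) :
    laplaceInv (cExtend u) n m (-j) = laplaceInv (cExtend u) (n + j) (m - j) j := by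
  unfold laplaceInv
  have e1 : -j + 1 = -(j - 1) := by ring
  have e2 : -j - 1 = -(j + 1) := by ring
  rw [e1, e2]
  simp only [cExtend_neg]
  have a1 : n + 1 + (j - 1) = n + j := by ring
  have a2 : m - 1 - (j - 1) = m - j := by ring
  have a3 : n + 1 + j = n + j + 1 := by ring
  have a4 : m - 1 - j = m - j - 1 := by ring
  have a5 : n + (j + 1) = n + j + 1 := by ring
  have a6 : m - (j + 1) = m - j - 1 := by ring
  rw [a1, a2, a3, a4, a5, a6]
  congr 1
  ring

/-- The `C`-series lattice of length `r` for the unknowns `u(0), …, u(r-1)`, at the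
point `(n, m)`: the equations with numbers `0 ≤ j < r` for the extended field. They only involve
the unknowns at the four vertices of the square with lower left corner `(n, m)`. -/
def CSeries (r : ℕ) (u : ℤ → ℤ → Fin r → ℝ) (n m : ℤ) : Prop :=
  ∀ j : Fin r, EquationAt (cExtend u) n m ((j : ℕ) : ℤ)

theorem equationAt_cExtend_neg {r : ℕ} (u : ℤ → ℤ → Fin r → ℝ) (n m j : ℤ) :
    EquationAt (cExtend u) n m (-j) ↔ EquationAt (cExtend u) (n + j) (m - j) j := by
  unfold EquationAt
  have e1 : -j + 1 = -(j - 1) := by ring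
  have e2 : -j - 1 = -(j + 1) := by ring
  rw [e1, e2]
  simp only [cExtend_neg]
  have a1 : n + 1 + (j - 1) = n + j := by ring
  have a2 : m - (j - 1) = m - j + 1 := by ring
  have a3 : n + 1 + j = n + j + 1 := by ring
  have a4 : m + 1 - j = m - j + 1 := by ring
  have a5 : n + (j + 1) = n + j + 1 := by ring
  have a6 : m + 1 - (j + 1) = m - j := by ring
  rw [a1, a2, a3, a4, a5, a6]
  have b : cExtend u (n + j + 1) (m - j) (j + 1) - cExtend u (n + j) (m - j + 1) j
      - cExtend u (n + j + 1) (m - j) j + cExtend u (n + j) (m - j + 1) (j - 1)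
      = cExtend u (n + j) (m - j + 1) (j - 1) - cExtend u (n + j) (m - j + 1) j
      - cExtend u (n + j + 1) (m - j) j + cExtend u (n + j + 1) (m - j) (j + 1) := by ring
  rw [b]

/-- The `C`-series lattice of length `r` is the reduction of the `A`-series lattice of the
double length to the fields that are fixed by the reflection. -/
theorem cSeries_iff_isASeriesSolution {r : ℕ} (u : ℤ → ℤ → Fin r → ℝ) :
    (∀ n m, CSeries r u n m) ↔ IsASeriesSolution r (cExtend u) := by
  constructor
  · intro h
    refine ⟨fun n m => by simp [cExtend], fun n m j h1 h2 => ?_⟩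
    rcases le_total 0 j with hj | hj
    · obtain ⟨k, rfl⟩ := Int.eq_ofNat_of_zero_le hj
      exact h n m ⟨k, by omega⟩
    · obtain ⟨k, hk⟩ := Int.eq_ofNat_of_zero_le (neg_nonneg.2 hj)
      obtain rfl : j = -(k : ℤ) := by omega
      rw [equationAt_cExtend_neg]
      exact h _ _ ⟨k, by omega⟩
  · intro h n m j
    exact h.2 n m _ (by omega) (by omega)

/-- The equations of the `C`-series lattice written out: a discrete exponential system. -/
theorem equationAt_cExtend_zero {r : ℕ} (u : ℤ → ℤ → Fin r → ℝ) (n m : ℤ) :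
    EquationAt (cExtend u) n m 0 ↔
      Real.exp (cExtend u (n + 1) (m + 1) 0 + cExtend u n m 0 - cExtend u (n + 1) m 0
        - cExtend u n (m + 1) 0) =
      1 + Real.exp (2 * cExtend u (n + 1) m 1 - cExtend u (n + 1) m 0 - cExtend u n (m + 1) 0) := by
  unfold EquationAt
  have h := cExtend_neg u n (m + 1) 1
  rw [show m + 1 - 1 = m by ring] at h
  rw [zero_sub, zero_add, h]
  ring_nf

/-! ### Integrals and Darboux integrability

A lattice with `r` unknowns is a predicate `S u n m`: the field `u` satisfies the equations on the
square with vertices `(n,m)`, `(n+1,m)`, `(n,m+1)`, `(n+1,m+1)`. -/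

/-- `F` depends on its `i`-th (vector) argument. -/
def DependsOnArg {d r : ℕ} (F : (Fin (d + 1) → Fin r → ℝ) → ℝ) (i : Fin (d + 1)) : Prop :=
  ∃ x y, (∀ k, k ≠ i → x k = y k) ∧ F x ≠ F y

/-- `F` has order `d`: as a function of `u_n, …, u_{n+d}` it depends on both `u_n` and
`u_{n+d}`. -/
def HasOrder {d r : ℕ} (F : (Fin (d + 1) → Fin r → ℝ) → ℝ) : Prop :=
  DependsOnArg F 0 ∧ DependsOnArg F (Fin.last d)

/-- `J` is an `m`-integral of order `d`: a function of `u_{n,m}, …, u_{n+d,m}` that does not change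
under the shift of `m`, by virtue of the equations of the lattice. -/
structure IsMIntegral {r : ℕ} (S : (ℤ → ℤ → Fin r → ℝ) → ℤ → ℤ → Prop) (d : ℕ)
    (J : (Fin (d + 1) → Fin r → ℝ) → ℝ) : Prop where
  smooth : ContDiff ℝ ∞ J
  hasOrder : HasOrder J
  invariant : ∀ (u : ℤ → ℤ → Fin r → ℝ) (n m : ℤ),
    (∀ i : ℕ, i < d → S u (n + i) m) →
      J (fun i => u (n + (i : ℕ)) (m + 1)) = J (fun i => u (n + (i : ℕ)) m)

/-- `I` is an `n`-integral of order `d`: a function of `u_{n,m}, …, u_{n,m+d}` that does not change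
under the shift of `n`, by virtue of the equations of the lattice. -/
structure IsNIntegral {r : ℕ} (S : (ℤ → ℤ → Fin r → ℝ) → ℤ → ℤ → Prop) (d : ℕ)
    (I : (Fin (d + 1) → Fin r → ℝ) → ℝ) : Prop where
  smooth : ContDiff ℝ ∞ I
  hasOrder : HasOrder I
  invariant : ∀ (u : ℤ → ℤ → Fin r → ℝ) (n m : ℤ),
    (∀ i : ℕ, i < d → S u n (m + i)) →
      I (fun i => u (n + 1) (m + (i : ℕ))) = I (fun i => u n (m + (i : ℕ)))

/-- The matrix `∂(F_1,…,F_k) / ∂(u_{n+d_1},…,u_{n+d_k})`: its entry in row `a` and column `j` is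
the partial derivative of `F_a` with respect to `u_{n+d_a}(j)`. Here `x i` is the value
of `u_{n+i}`. -/
noncomputable def leadingMatrix {k r : ℕ} (d : Fin k → ℕ)
    (F : (a : Fin k) → (Fin (d a + 1) → Fin r → ℝ) → ℝ) (x : ℕ → Fin r → ℝ) :
    Matrix (Fin k) (Fin r) ℝ :=
  Matrix.of fun a j =>
    fderiv ℝ (F a) (fun i => x (i : ℕ)) (Pi.single (Fin.last (d a)) (Pi.single j 1))

/-- Essential independence of `F_1,…,F_k` of orders `d_1,…,d_k`: the leading matrix has
rank `k` everywhere. -/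
def EssentiallyIndependent {k r : ℕ} (d : Fin k → ℕ)
    (F : (a : Fin k) → (Fin (d a + 1) → Fin r → ℝ) → ℝ) : Prop :=
  ∀ x : ℕ → Fin r → ℝ, (leadingMatrix d F x).rank = k

/-- A lattice with `r` unknowns is Darboux integrable if it admits complete families (of `r`
elements) of essentially independent `n`-integrals and of essentially independent
`m`-integrals. -/
def DarbouxIntegrable {r : ℕ} (S : (ℤ → ℤ → Fin r → ℝ) → ℤ → ℤ → Prop) : Prop :=
  (∃ (d : Fin r → ℕ) (I : (a : Fin r) → (Fin (d a + 1) → Fin r → ℝ) → ℝ),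
    (∀ a, IsNIntegral S (d a) (I a)) ∧ EssentiallyIndependent d I) ∧
  (∃ (d : Fin r → ℕ) (J : (a : Fin r) → (Fin (d a + 1) → Fin r → ℝ) → ℝ),
    (∀ a, IsMIntegral S (d a) (J a)) ∧ EssentiallyIndependent d J)

end Toda

/-!
Put `D_s(n) = exp u_{n,m}(r - s)` for a fixed `m`, and let `D'_s` be the same for `m + 1`. The
lattice becomes the Hirota bilinear equation
`D'_s(n+1) D_s(n) = D_s(n+1) D'_s(n) + D'_{s+1}(n) D_{s-1}(n+1)` with `D_0 = 1`, and the reflection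
turns the product in the equation `s = r` into `D_{r-1}(n+1) ^ 2`. Its solutions are Casorati
determinants: `D_s(n)` is the Casoratian of `f(·, m), …, f(·, m-s+1)`, where `f = D_1`. The
reflection means that the `f(·, m)` are solutions of a *self-adjoint* difference equation of order
`2 r` in `n` which does not depend on `m`, and the coefficients of this equation are the
`m`-integrals.

To express them in the unknowns with a fixed `m`, one factorizes. Let `T` be the shift of `n`. The
operator `P_s = (T - x_s) ⋯ (T - x_1)` with
`x_s(n) = D_s(n+1) D_{s-1}(n) / (D_s(n) D_{s-1}(n+1))` annihilates `f(·, m), …, f(·, m-s+1)`, and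
the self-adjoint operator is `P_r† w P_r` with `w(n) = D_r(n) / D_r(n+1)`. The proof works with the
coefficients of these operators and never needs `f`. The operators of the rows `m` and `m + 1` are
related by `P'_s = (T - y_s) P_{s-1}` (`opCoeff_succ_eq_exchange`), which follows from the bilinear
equations with `s < r`; the equation with `s = r` says that `(T - x_r)† w (T - x_r)` and
`(T - y_r)† w' (T - y_r)` coincide (`factorCoeff_mul_weight`, `weight_sub_eq`). Hence the
coefficients of `P_r† w P_r` are invariant (`selfAdjCoeff_invariant`).

The coefficient of `T ^ k`, `0 ≤ k < r`, at the point `r - k` depends on the values of `D` on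
`0, …, r + 1`, so that all integrals have order `r + 1`. Among the `D_s(r+1)`, it contains only
those with `s ≤ r - k`, and it is linear in `D_{r-k}(r+1)` with a nonzero coefficient
(`selfAdjCoeff_eq_of_top`, `selfAdjCoeff_sub_of_top`). Therefore the leading matrix is triangular
with a nonzero diagonal. The same holds at the other end, for the `D_s(0)` with `s ≥ r - k`
(`selfAdjCoeff_eq_of_bot`, `selfAdjCoeff_sub_of_bot`).

The lattice is invariant under `(n, m) ↦ (-m, -n)` (`cSeries_swap`). Thus the `m`-integrals with
their arguments in the reverse order are `n`-integrals, and their leading matrix is the one of the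
`m`-integrals at the other end.
-/

namespace Toda

open Finset

/-! ### Difference operators attached to a tau function -/

/-- The coefficient `x_{s+1}(n)` of the first order factor `T - x_{s+1}`, where `T` is the shift
of `n`. -/
noncomputable def factorCoeff (D : ℕ → ℤ → ℝ) (s : ℕ) (n : ℤ) : ℝ :=
  D (s + 1) (n + 1) * D s n / (D (s + 1) n * D s (n + 1))

/-- The coefficient of `T ^ i` at the point `n` in the difference operator
`P_s = (T - x_s) ⋯ (T - x_1)`. It is indexed by all integers `i`, and vanishes unless
`0 ≤ i ≤ s`. -/
noncomputable def opCoeff (D : ℕ → ℤ → ℝ) : ℕ → ℤ → ℤ → ℝ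
  | 0, i, _ => if i = 0 then 1 else 0
  | s + 1, i, n => opCoeff D s (i - 1) (n + 1) - factorCoeff D s n * opCoeff D s i n

/-- The weight `w` in the operator `P_r† w P_r`. -/
noncomputable def weight (D : ℕ → ℤ → ℝ) (r : ℕ) (n : ℤ) : ℝ := D r n / D r (n + 1)

/-- The coefficient of `T ^ k` at the point `r - k` in the self-adjoint operator `P_r† w P_r`. If
`p_i` are the coefficients of `P_r`, the product of `T ^ (-i) p_i` and `w p_{i+k} T ^ (i + k)`
contributes `w(a) p_i(a) p_{i+k}(a)` with `a = r - k - i`, and the sum is over this `a`. With this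
choice of the point, only the values of `D` on `0, …, r + 1` are involved. -/
noncomputable def selfAdjCoeff (D : ℕ → ℤ → ℝ) (r k : ℕ) : ℝ :=
  ∑ a ∈ range (r - k + 1),
    weight D r a * opCoeff D r ((r : ℤ) - k - a) a * opCoeff D r ((r : ℤ) - a) a

theorem opCoeff_of_neg (D : ℕ → ℤ → ℝ) (s : ℕ) (i n : ℤ) (hi : i < 0) : opCoeff D s i n = 0 := by
  induction s generalizing i n with
  | zero => simp [opCoeff, hi.ne]
  | succ s ih => simp [opCoeff, ih i n hi, ih (i - 1) (n + 1) (by omega)]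

theorem opCoeff_of_gt (D : ℕ → ℤ → ℝ) (s : ℕ) (i n : ℤ) (hi : s < i) : opCoeff D s i n = 0 := by
  induction s generalizing i n with
  | zero => simp at hi; simp [opCoeff, hi.ne']
  | succ s ih =>
    push_cast at hi
    simp [opCoeff, ih i n (by omega), ih (i - 1) (n + 1) (by omega)]

theorem opCoeff_self (D : ℕ → ℤ → ℝ) (s : ℕ) (n : ℤ) : opCoeff D s s n = 1 := by
  induction s generalizing n with
  | zero => simp [opCoeff]
  | succ s ih =>
    have h := opCoeff_of_gt D s ((s + 1 : ℕ) : ℤ) n (by push_cast; omega)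
    have e : ((s + 1 : ℕ) : ℤ) - 1 = s := by push_cast; ring
    simp only [opCoeff, h, e, ih]
    ring

theorem opCoeff_zero (D : ℕ → ℤ → ℝ) (hD : ∀ s n, 0 < D s n) (h0 : ∀ n, D 0 n = 1)
    (s : ℕ) (n : ℤ) : opCoeff D s 0 n = (-1) ^ s * (D s (n + 1) / D s n) := by
  induction s with
  | zero => simp [opCoeff, h0]
  | succ s ih =>
    have h1 := (hD s n).ne'
    have h2 := (hD s (n + 1)).ne'
    have h3 := (hD (s + 1) n).ne'
    simp only [opCoeff, ih, opCoeff_of_neg D s (0 - 1) (n + 1) (by omega), factorCoeff]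
    field_simp
    ring

/-! ### Invariance under the shift of `m` -/

/-- The coefficient `y_{s+1}(n)` of the first order operator with
`P'_{s+1} = (T - y_{s+1}) P_s`. -/
noncomputable def exchangeCoeff (D D' : ℕ → ℤ → ℝ) (s : ℕ) (n : ℤ) : ℝ :=
  D' (s + 1) (n + 1) * D s n / (D' (s + 1) n * D s (n + 1))

/-- The bilinear (Hirota) form of the Toda equation with number `j = r - (s + 1)` at the point `n`,
for the tau functions `D` and `D'` of two consecutive rows `m` and `m + 1`. -/
def Bilinear (D D' : ℕ → ℤ → ℝ) (s : ℕ) (n : ℤ) : Prop :=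
  D' (s + 1) (n + 1) * D (s + 1) n =
    D (s + 1) (n + 1) * D' (s + 1) n + D' (s + 2) n * D s (n + 1)

/-- The `T`-coefficients in the exchange relation
`(T - x'_{s+2}) (T - y_{s+1}) = (T - y_{s+2}) (T - x_{s+1})`. -/
theorem factorCoeff_add_exchangeCoeff (D D' : ℕ → ℤ → ℝ) (hD : ∀ s n, 0 < D s n)
    (hD' : ∀ s n, 0 < D' s n) (s : ℕ) (n : ℤ) (h1 : Bilinear D D' s n)
    (h2 : Bilinear D D' s (n + 1)) :
    factorCoeff D' (s + 1) n + exchangeCoeff D D' s (n + 1) =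
      exchangeCoeff D D' (s + 1) n + factorCoeff D s (n + 1) := by
  have e1 : factorCoeff D' (s + 1) n - exchangeCoeff D D' (s + 1) n =
      -(D' (s + 2) (n + 1) * D s (n + 1)) / (D' (s + 1) (n + 1) * D (s + 1) (n + 1)) := by
    have a1 := (hD (s + 1) (n + 1)).ne'
    have a2 := (hD' (s + 1) (n + 1)).ne'
    have a3 := (hD' (s + 2) n).ne'
    unfold factorCoeff exchangeCoeff
    unfold Bilinear at h1
    simp only [add_assoc, Nat.reduceAdd]
    field_simp
    linear_combination -(D' (s + 2) (n + 1)) * h1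
  have e2 : factorCoeff D s (n + 1) - exchangeCoeff D D' s (n + 1) =
      -(D' (s + 2) (n + 1) * D s (n + 1)) / (D' (s + 1) (n + 1) * D (s + 1) (n + 1)) := by
    have a1 := (hD (s + 1) (n + 1)).ne'
    have a2 := (hD' (s + 1) (n + 1)).ne'
    have a3 := (hD s (n + 1 + 1)).ne'
    unfold factorCoeff exchangeCoeff
    unfold Bilinear at h2
    field_simp
    linear_combination -(D s (n + 1)) * h2
  linear_combination e1 - e2

theorem factorCoeff_mul_exchangeCoeff (D D' : ℕ → ℤ → ℝ) (hD : ∀ s n, 0 < D s n)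
    (hD' : ∀ s n, 0 < D' s n) (s : ℕ) (n : ℤ) :
    factorCoeff D' (s + 1) n * exchangeCoeff D D' s n =
      exchangeCoeff D D' (s + 1) n * factorCoeff D s n := by
  have a1 := (hD (s + 1) n).ne'
  have a2 := (hD' (s + 1) n).ne'
  have a3 := (hD' (s + 2) n).ne'
  have a4 := (hD (s + 1) (n + 1)).ne'
  have a5 := (hD' (s + 1) (n + 1)).ne'
  have a6 := (hD s (n + 1)).ne'
  unfold factorCoeff exchangeCoeff
  simp only [add_assoc, Nat.reduceAdd]
  field_simp

/-- The operators of two consecutive rows are related by `P'_{s+1} = (T - y_{s+1}) P_s`. The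
statement is local: the coefficient of `T ^ i` at `n` only needs the equations on `n, …, n + i`. -/
theorem opCoeff_succ_eq_exchange (D D' : ℕ → ℤ → ℝ) (hD : ∀ s n, 0 < D s n)
    (hD' : ∀ s n, 0 < D' s n) (h0 : ∀ n, D 0 n = 1) (h0' : ∀ n, D' 0 n = 1) (L s : ℕ)
    (h : ∀ t < s, ∀ n : ℤ, 0 ≤ n → n ≤ L → Bilinear D D' t n)
    (i n : ℤ) (hn : 0 ≤ n) (hni : n + i ≤ L) :
    opCoeff D' (s + 1) i n =
      opCoeff D s (i - 1) (n + 1) - exchangeCoeff D D' s n * opCoeff D s i n := by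
  induction s generalizing i n with
  | zero => simp [opCoeff, factorCoeff, exchangeCoeff, h0, h0']
  | succ s ih =>
    have ih' := ih fun t ht => h t (by omega)
    rw [opCoeff, ih' i n hn hni, ih' (i - 1) (n + 1) (by omega) (by omega), opCoeff, opCoeff]
    have e2 := factorCoeff_mul_exchangeCoeff D D' hD hD' s n
    rcases le_or_gt i 0 with hi | hi
    · rw [opCoeff_of_neg D s (i - 1) (n + 1) (by omega)]
      linear_combination opCoeff D s i n * e2
    · have e1 := factorCoeff_add_exchangeCoeff D D' hD hD' s n
        (h s (by omega) n hn (by omega)) (h s (by omega) (n + 1) (by omega) (by omega))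
      linear_combination opCoeff D s i n * e2 - opCoeff D s (i - 1) (n + 1) * e1

/-- The boundary form of the bilinear Toda equation, for the largest index `s + 1`: by the
reflection, `D' (s + 2) n` is replaced with `D s (n + 1)`. -/
def BilinearBoundary (D D' : ℕ → ℤ → ℝ) (s : ℕ) (n : ℤ) : Prop :=
  D' (s + 1) (n + 1) * D (s + 1) n = D (s + 1) (n + 1) * D' (s + 1) n + D s (n + 1) ^ 2

theorem factorCoeff_mul_weight (D D' : ℕ → ℤ → ℝ) (hD : ∀ s n, 0 < D s n)
    (hD' : ∀ s n, 0 < D' s n) (s : ℕ) (n : ℤ) :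
    factorCoeff D s n * weight D (s + 1) n = exchangeCoeff D D' s n * weight D' (s + 1) n := by
  have a1 := (hD (s + 1) n).ne'
  have a2 := (hD' (s + 1) n).ne'
  have a4 := (hD (s + 1) (n + 1)).ne'
  have a5 := (hD' (s + 1) (n + 1)).ne'
  unfold factorCoeff exchangeCoeff weight
  field_simp

/-- The diagonal coefficients of `(T - x)† w (T - x)` and `(T - y)† w' (T - y)` agree. -/
theorem weight_sub_eq (D D' : ℕ → ℤ → ℝ) (hD : ∀ s n, 0 < D s n)
    (hD' : ∀ s n, 0 < D' s n) (s : ℕ) (n : ℤ) (h1 : BilinearBoundary D D' s (n - 1))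
    (h2 : BilinearBoundary D D' s n) :
    exchangeCoeff D D' s n ^ 2 * weight D' (s + 1) n - factorCoeff D s n ^ 2 * weight D (s + 1) n =
      -(weight D' (s + 1) (n - 1) - weight D (s + 1) (n - 1)) := by
  have a1 := (hD (s + 1) n).ne'
  have a2 := (hD' (s + 1) n).ne'
  have a4 := (hD (s + 1) (n + 1)).ne'
  have a5 := (hD' (s + 1) (n + 1)).ne'
  have a6 := (hD s (n + 1)).ne'
  unfold BilinearBoundary at h1 h2
  rw [sub_add_cancel] at h1
  have e1 : exchangeCoeff D D' s n ^ 2 * weight D' (s + 1) n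
      - factorCoeff D s n ^ 2 * weight D (s + 1) n
      = D s n ^ 2 / (D (s + 1) n * D' (s + 1) n) := by
    unfold factorCoeff exchangeCoeff weight
    field_simp
    linear_combination D s n ^ 2 * h2
  have e2 : weight D' (s + 1) (n - 1) - weight D (s + 1) (n - 1)
      = -(D s n ^ 2) / (D (s + 1) n * D' (s + 1) n) := by
    unfold weight
    rw [sub_add_cancel]
    field_simp
    linear_combination -h1
  rw [e1, e2]
  ring

/-- The coefficients of the self-adjoint operator are the same for two consecutive rows, by virtue
of the bilinear equations on the squares `0, …, r`, where `r = s + 1`. -/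
theorem selfAdjCoeff_invariant (D D' : ℕ → ℤ → ℝ) (hD : ∀ s n, 0 < D s n)
    (hD' : ∀ s n, 0 < D' s n) (h0 : ∀ n, D 0 n = 1) (h0' : ∀ n, D' 0 n = 1) (s k : ℕ)
    (hk : k ≤ s)
    (h : ∀ t < s, ∀ n : ℤ, 0 ≤ n → n ≤ (s + 1 : ℕ) → Bilinear D D' t n)
    (hb : ∀ n : ℤ, 0 ≤ n → n ≤ (s + 1 : ℕ) → BilinearBoundary D D' s n) :
    selfAdjCoeff D' (s + 1) k = selfAdjCoeff D (s + 1) k := by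
  -- With `P = (T - x) Q` and `P' = (T - y) Q`, the difference of the summands telescopes.
  set F : ℕ → ℝ := fun a => (weight D' (s + 1) ((a : ℤ) - 1) - weight D (s + 1) ((a : ℤ) - 1)) *
    (opCoeff D s (((s + 1 : ℕ) : ℤ) - k - a) a * opCoeff D s (((s + 1 : ℕ) : ℤ) - a) a) with hF
  have hF0 : F 0 = 0 := by
    simp only [hF]
    rw [opCoeff_of_gt D s (((s + 1 : ℕ) : ℤ) - (0 : ℕ)) _ (by push_cast; omega)]
    ring
  have hF1 : F (s + 1 - k + 1) = 0 := by
    simp only [hF]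
    rw [opCoeff_of_neg D s (((s + 1 : ℕ) : ℤ) - k - (s + 1 - k + 1 : ℕ)) _ (by omega)]
    ring
  rw [← sub_eq_zero]
  unfold selfAdjCoeff
  rw [← sum_sub_distrib]
  have key : ∀ a ∈ range (s + 1 - k + 1),
      weight D' (s + 1) a * opCoeff D' (s + 1) (((s + 1 : ℕ) : ℤ) - k - a) a *
          opCoeff D' (s + 1) (((s + 1 : ℕ) : ℤ) - a) a -
        weight D (s + 1) a * opCoeff D (s + 1) (((s + 1 : ℕ) : ℤ) - k - a) a *
          opCoeff D (s + 1) (((s + 1 : ℕ) : ℤ) - a) a = F (a + 1) - F a := by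
    intro a ha
    rw [mem_range] at ha
    rw [opCoeff_succ_eq_exchange D D' hD hD' h0 h0' (s + 1) s h _ a (by omega) (by omega),
      opCoeff_succ_eq_exchange D D' hD hD' h0 h0' (s + 1) s h _ a (by omega) (by omega),
      opCoeff, opCoeff]
    have e := factorCoeff_mul_weight D D' hD hD' s a
    have c1 : ((s + 1 : ℕ) : ℤ) - k - ((a : ℤ) + 1) = ((s + 1 : ℕ) : ℤ) - k - a - 1 := by ring
    have c2 : ((s + 1 : ℕ) : ℤ) - ((a : ℤ) + 1) = ((s + 1 : ℕ) : ℤ) - a - 1 := by ring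
    have c3 : (a : ℤ) + 1 - 1 = a := by ring
    have c4 : ((a + 1 : ℕ) : ℤ) = a + 1 := by push_cast; ring
    simp only [hF, c1, c2, c3, c4]
    set A := opCoeff D s (((s + 1 : ℕ) : ℤ) - k - a - 1) (a + 1)
    set B := opCoeff D s (((s + 1 : ℕ) : ℤ) - a - 1) (a + 1)
    set A' := opCoeff D s (((s + 1 : ℕ) : ℤ) - k - a) a
    set B' := opCoeff D s (((s + 1 : ℕ) : ℤ) - a) a with hB'
    have e2 : (exchangeCoeff D D' s a ^ 2 * weight D' (s + 1) a
        - factorCoeff D s a ^ 2 * weight D (s + 1) a) * B' =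
        -(weight D' (s + 1) ((a : ℤ) - 1) - weight D (s + 1) ((a : ℤ) - 1)) * B' := by
      rcases Nat.eq_zero_or_pos a with rfl | hpos
      · rw [hB', opCoeff_of_gt D s _ _ (by push_cast; omega)]
        ring
      · rw [weight_sub_eq D D' hD hD' s a (hb _ (by omega) (by omega)) (hb _ (by omega) (by omega))]
    linear_combination A' * e2 + (A * B' + A' * B) * e
  rw [sum_congr rfl key, sum_range_sub, hF0, hF1, sub_zero]

/-! ### Dependence on the extreme values of the tau function -/

/-- The coefficient of `T ^ i` at `n` only involves the values of `D` on `n, …, n + i + 1`. -/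
theorem opCoeff_congr (D D' : ℕ → ℤ → ℝ) (s : ℕ) (i n : ℤ)
    (h : ∀ t m, n ≤ m → m ≤ n + i + 1 → D' t m = D t m) : opCoeff D' s i n = opCoeff D s i n := by
  induction s generalizing i n with
  | zero => rfl
  | succ s ih =>
    rw [opCoeff, opCoeff, ih (i - 1) (n + 1) fun t m h1 h2 => h t m (by omega) (by omega)]
    rcases lt_or_ge i 0 with hi | hi
    · rw [opCoeff_of_neg D s i n hi, opCoeff_of_neg D' s i n hi]
      ring
    · rw [ih i n h]
      unfold factorCoeff
      rw [h _ _ le_rfl (by omega), h _ _ le_rfl (by omega), h _ (n + 1) (by omega) (by omega),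
        h _ (n + 1) (by omega) (by omega)]

/-- The value `D s₀ M` does not enter the coefficients of `P_s` that end at `M` and have
codegree less than `s₀`. -/
theorem opCoeff_eq_of_top (D D' : ℕ → ℤ → ℝ) (hD : ∀ s n, 0 < D s n)
    (hD' : ∀ s n, 0 < D' s n) (h0 : ∀ n, D 0 n = 1) (h0' : ∀ n, D' 0 n = 1) (s₀ : ℕ) (M : ℤ)
    (h : ∀ t m, m ≤ M → (t, m) ≠ (s₀, M) → D' t m = D t m)
    (s : ℕ) (i n : ℤ) (hn : n + i + 1 = M) (hs : s - i < s₀) :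
    opCoeff D' s i n = opCoeff D s i n := by
  induction s generalizing i n with
  | zero => rfl
  | succ s ih =>
    push_cast at hs
    rcases lt_trichotomy i 0 with hi | rfl | hi
    · rw [opCoeff_of_neg D _ i n hi, opCoeff_of_neg D' _ i n hi]
    · rw [opCoeff_zero D hD h0, opCoeff_zero D' hD' h0', h _ _ (by omega) (by simp; omega),
        h _ _ (by omega) (by simp; omega)]
    · rw [opCoeff, opCoeff, ih (i - 1) (n + 1) (by omega) (by omega), ih i n hn (by omega)]
      unfold factorCoeff
      rw [h _ _ (by omega) (by simp; omega), h _ _ (by omega) (by simp; omega),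
        h _ _ (by omega) (by simp; omega), h _ _ (by omega) (by simp; omega)]

/-- In codegree `s₀`, the coefficients of `P_s` that end at `M` are linear in `D s₀ M`. The
nonconstant part comes from the trailing coefficient of `P_{s₀}`, and each further factor
`T - x` carries it over to the next degree. -/
theorem opCoeff_sub_of_top (D D' : ℕ → ℤ → ℝ) (hD : ∀ s n, 0 < D s n)
    (hD' : ∀ s n, 0 < D' s n) (h0 : ∀ n, D 0 n = 1) (h0' : ∀ n, D' 0 n = 1) (s₀ : ℕ) (M : ℤ)
    (h : ∀ t m, m ≤ M → (t, m) ≠ (s₀, M) → D' t m = D t m)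
    (i : ℕ) (n : ℤ) (hn : n + i + 1 = M) :
    opCoeff D' (s₀ + i) i n - opCoeff D (s₀ + i) i n =
      (-1) ^ s₀ * ((D' s₀ M - D s₀ M) / D s₀ (M - 1)) := by
  induction i generalizing n with
  | zero =>
    obtain rfl : n + 1 = M := by simpa using hn
    rw [add_zero, Nat.cast_zero, opCoeff_zero D hD h0, opCoeff_zero D' hD' h0',
      h _ n (by omega) (by simp), add_sub_cancel_right]
    ring
  | succ i ih =>
    push_cast at hn
    have e := ih (n + 1) (by omega)
    rw [← add_assoc, opCoeff, opCoeff,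
      opCoeff_eq_of_top D D' hD hD' h0 h0' s₀ M h _ ((i + 1 : ℕ) : ℤ) n (by push_cast; omega)
        (by push_cast; omega)]
    have e' : ((i + 1 : ℕ) : ℤ) - 1 = i := by push_cast; ring
    rw [e', ← e]
    unfold factorCoeff
    rw [h _ _ (by omega) (by simp; omega), h _ _ (by omega) (by simp; omega),
      h _ _ (by omega) (by simp; omega), h _ _ (by omega) (by simp; omega)]
    ring

theorem weight_mul_opCoeff_zero (D : ℕ → ℤ → ℝ) (hD : ∀ s n, 0 < D s n) (h0 : ∀ n, D 0 n = 1)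
    (s : ℕ) (n : ℤ) : weight D s n * opCoeff D s 0 n = (-1) ^ s := by
  rw [opCoeff_zero D hD h0, weight]
  have a1 := (hD s n).ne'
  have a2 := (hD s (n + 1)).ne'
  field_simp

/-- The summands other than the last one do not contain `D s₀ (r + 1)` if `r - k ≤ s₀`. -/
theorem selfAdjCoeff_sub_eq_last (D D' : ℕ → ℤ → ℝ) (hD : ∀ s n, 0 < D s n)
    (hD' : ∀ s n, 0 < D' s n) (h0 : ∀ n, D 0 n = 1) (h0' : ∀ n, D' 0 n = 1) (r k s₀ : ℕ)
    (hk : k < r) (hs : r - k ≤ s₀)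
    (h : ∀ t m, m ≤ (r : ℤ) + 1 → (t, m) ≠ (s₀, (r : ℤ) + 1) → D' t m = D t m) :
    selfAdjCoeff D' r k - selfAdjCoeff D r k =
      (-1) ^ r * (opCoeff D' r k ((r - k : ℕ) : ℤ) - opCoeff D r k ((r - k : ℕ) : ℤ)) := by
  unfold selfAdjCoeff
  rw [sum_range_succ, sum_range_succ]
  have c1 : (r : ℤ) - k - ((r - k : ℕ) : ℤ) = 0 := by omega
  have c2 : (r : ℤ) - ((r - k : ℕ) : ℤ) = k := by omega
  rw [c1, c2, weight_mul_opCoeff_zero D hD h0, weight_mul_opCoeff_zero D' hD' h0',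
    sum_congr rfl (g := fun a : ℕ =>
      weight D r a * opCoeff D r ((r : ℤ) - k - a) a * opCoeff D r ((r : ℤ) - a) a)]
  · ring
  · intro a ha
    rw [mem_range] at ha
    rw [opCoeff_eq_of_top D D' hD hD' h0 h0' s₀ _ h r ((r : ℤ) - a) a (by omega) (by omega)]
    have e : opCoeff D' r ((r : ℤ) - k - a) a = opCoeff D r ((r : ℤ) - k - a) a := by
      rcases Nat.eq_zero_or_pos k with rfl | hk0
      · exact opCoeff_eq_of_top D D' hD hD' h0 h0' s₀ _ h r _ a (by omega) (by omega)
      · exact opCoeff_congr D D' r _ a fun t m h1 h2 => h t m (by omega) (by simp; omega)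
    rw [e]
    unfold weight
    rw [h _ _ (by omega) (by simp; omega), h _ _ (by omega) (by simp; omega)]

theorem selfAdjCoeff_eq_of_top (D D' : ℕ → ℤ → ℝ) (hD : ∀ s n, 0 < D s n)
    (hD' : ∀ s n, 0 < D' s n) (h0 : ∀ n, D 0 n = 1) (h0' : ∀ n, D' 0 n = 1) (r k s₀ : ℕ)
    (hk : k < r) (hs : r - k < s₀)
    (h : ∀ t m, m ≤ (r : ℤ) + 1 → (t, m) ≠ (s₀, (r : ℤ) + 1) → D' t m = D t m) :
    selfAdjCoeff D' r k = selfAdjCoeff D r k := by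
  rw [← sub_eq_zero, selfAdjCoeff_sub_eq_last D D' hD hD' h0 h0' r k s₀ hk hs.le h,
    opCoeff_eq_of_top D D' hD hD' h0 h0' s₀ _ h r k _ (by omega) (by omega)]
  ring

theorem selfAdjCoeff_sub_of_top (D D' : ℕ → ℤ → ℝ) (hD : ∀ s n, 0 < D s n)
    (hD' : ∀ s n, 0 < D' s n) (h0 : ∀ n, D 0 n = 1) (h0' : ∀ n, D' 0 n = 1) (r k : ℕ)
    (hk : k < r)
    (h : ∀ t m, m ≤ (r : ℤ) + 1 → (t, m) ≠ (r - k, (r : ℤ) + 1) → D' t m = D t m) :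
    selfAdjCoeff D' r k - selfAdjCoeff D r k =
      (-1) ^ k * ((D' (r - k) (r + 1) - D (r - k) (r + 1)) / D (r - k) r) := by
  rw [selfAdjCoeff_sub_eq_last D D' hD hD' h0 h0' r k (r - k) hk le_rfl h]
  have e := opCoeff_sub_of_top D D' hD hD' h0 h0' (r - k) _ h k ((r - k : ℕ) : ℤ) (by omega)
  rw [Nat.sub_add_cancel hk.le, add_sub_cancel_right] at e
  rw [e, ← mul_assoc, ← pow_add]
  congr 1
  have : r + (r - k) = 2 * (r - k) + k := by omega
  rw [this, pow_add, pow_mul]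
  norm_num

/-- The recursion for the coefficients multiplied by the weight: it is free of `x_{s+1}`, since
`w_{s+1} x_{s+1} = w_s`. -/
theorem weight_mul_opCoeff_succ (D : ℕ → ℤ → ℝ) (hD : ∀ s n, 0 < D s n) (s : ℕ) (i n : ℤ) :
    weight D (s + 1) n * opCoeff D (s + 1) i n =
      weight D (s + 1) n * opCoeff D s (i - 1) (n + 1) - weight D s n * opCoeff D s i n := by
  have a1 := (hD (s + 1) n).ne'
  have a2 := (hD (s + 1) (n + 1)).ne'
  have a3 := (hD s (n + 1)).ne'
  rw [opCoeff]
  unfold weight factorCoeff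
  field_simp

/-- At the initial point `N`, the weighted coefficient of `T ^ i` contains only those `D t N` with
`i ≤ t ≤ s`. -/
theorem weight_mul_opCoeff_eq_of_bot (D D' : ℕ → ℤ → ℝ) (hD : ∀ s n, 0 < D s n)
    (hD' : ∀ s n, 0 < D' s n) (h0 : ∀ n, D 0 n = 1) (h0' : ∀ n, D' 0 n = 1) (s₀ : ℕ) (N : ℤ)
    (h : ∀ t m, N ≤ m → (t, m) ≠ (s₀, N) → D' t m = D t m)
    (s : ℕ) (i : ℤ) (hs : s < s₀ ∨ s₀ < i) :
    weight D' s N * opCoeff D' s i N = weight D s N * opCoeff D s i N := by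
  induction s with
  | zero => simp [weight, h0, h0', opCoeff]
  | succ s ih =>
    rw [weight_mul_opCoeff_succ D hD, weight_mul_opCoeff_succ D' hD', ih (by omega),
      opCoeff_congr D D' s (i - 1) (N + 1)
        fun t m h1 h2 => h t m (by omega) (by simp; omega)]
    by_cases hi : (s : ℤ) + 1 < i
    · rw [opCoeff_of_gt D s (i - 1) _ (by omega)]
      ring
    · unfold weight
      rw [h _ _ le_rfl (by simp; omega), h _ _ (by omega) (by simp)]

theorem weight_mul_opCoeff_sub_of_bot (D D' : ℕ → ℤ → ℝ) (hD : ∀ s n, 0 < D s n)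
    (hD' : ∀ s n, 0 < D' s n) (s₀ : ℕ) (N : ℤ)
    (h : ∀ t m, N ≤ m → (t, m) ≠ (s₀, N) → D' t m = D t m) (j : ℕ) :
    weight D' (s₀ + j) N * opCoeff D' (s₀ + j) s₀ N - weight D (s₀ + j) N *
      opCoeff D (s₀ + j) s₀ N = (-1) ^ j * ((D' s₀ N - D s₀ N) / D s₀ (N + 1)) := by
  induction j with
  | zero =>
    rw [add_zero, opCoeff_self, opCoeff_self]
    unfold weight
    rw [h _ (N + 1) (by omega) (by simp)]
    ring
  | succ j ih =>
    rw [← add_assoc, weight_mul_opCoeff_succ D hD, weight_mul_opCoeff_succ D' hD',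
      opCoeff_congr D D' (s₀ + j) (s₀ - 1) (N + 1)
        fun t m h1 h2 => h t m (by omega) (by simp; omega), pow_succ, mul_neg_one, neg_mul, ← ih]
    unfold weight
    rw [h (s₀ + j + 1) N le_rfl (by simp; omega), h (s₀ + j + 1) (N + 1) (by omega) (by simp)]
    ring

/-- Only the summand number `0` contains the values of `D` at `0`. -/
theorem selfAdjCoeff_sub_eq_first (D D' : ℕ → ℤ → ℝ) (r k : ℕ) (hk : k < r)
    (h : ∀ t m, 1 ≤ m → D' t m = D t m) :
    selfAdjCoeff D' r k - selfAdjCoeff D r k =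
      weight D' r 0 * opCoeff D' r ((r - k : ℕ) : ℤ) 0 -
        weight D r 0 * opCoeff D r ((r - k : ℕ) : ℤ) 0 := by
  unfold selfAdjCoeff
  rw [sum_range_succ', sum_range_succ', sum_congr rfl (g := fun a : ℕ =>
      weight D r (a + 1 : ℕ) * opCoeff D r ((r : ℤ) - k - (a + 1 : ℕ)) (a + 1 : ℕ) *
        opCoeff D r ((r : ℤ) - (a + 1 : ℕ)) (a + 1 : ℕ))]
  · have c : (r : ℤ) - k = ((r - k : ℕ) : ℤ) := by omega
    simp only [Nat.cast_zero, sub_zero, opCoeff_self, c]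
    ring
  · intro a _
    rw [opCoeff_congr D D' r _ ((a + 1 : ℕ) : ℤ) fun t m h1 h2 => h t m (by omega),
      opCoeff_congr D D' r _ ((a + 1 : ℕ) : ℤ) fun t m h1 h2 => h t m (by omega)]
    unfold weight
    rw [h _ _ (by omega), h _ _ (by omega)]

theorem selfAdjCoeff_eq_of_bot (D D' : ℕ → ℤ → ℝ) (hD : ∀ s n, 0 < D s n)
    (hD' : ∀ s n, 0 < D' s n) (h0 : ∀ n, D 0 n = 1) (h0' : ∀ n, D' 0 n = 1) (r k s₀ : ℕ)
    (hk : k < r) (hs : s₀ < r - k)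
    (h : ∀ t m, 0 ≤ m → (t, m) ≠ (s₀, (0 : ℤ)) → D' t m = D t m) :
    selfAdjCoeff D' r k = selfAdjCoeff D r k := by
  rw [← sub_eq_zero, selfAdjCoeff_sub_eq_first D D' r k hk
      fun t m hm => h t m (by omega) (by simp; omega),
    weight_mul_opCoeff_eq_of_bot D D' hD hD' h0 h0' s₀ 0 h r _ (by omega), sub_self]

theorem selfAdjCoeff_sub_of_bot (D D' : ℕ → ℤ → ℝ) (hD : ∀ s n, 0 < D s n)
    (hD' : ∀ s n, 0 < D' s n) (r k : ℕ)
    (hk : k < r) (h : ∀ t m, 0 ≤ m → (t, m) ≠ (r - k, (0 : ℤ)) → D' t m = D t m) :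
    selfAdjCoeff D' r k - selfAdjCoeff D r k =
      (-1) ^ k * ((D' (r - k) 0 - D (r - k) 0) / D (r - k) 1) := by
  rw [selfAdjCoeff_sub_eq_first D D' r k hk fun t m hm => h t m (by omega) (by simp; omega)]
  have e := weight_mul_opCoeff_sub_of_bot D D' hD hD' (r - k) 0 h k
  rwa [Nat.sub_add_cancel hk.le, zero_add] at e

/-! ### The integrals as functions of the dynamic variables -/

/-- The row `D_s(n) = exp u_n(r - s)` of the tau function that is given by the values `X n` of the
unknowns at the points `0, …, r + 1`. The boundary condition `u(r) = 0` is `D_0 = 1`; the values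
outside of the range of definition are set to `1`. -/
noncomputable def tau {r : ℕ} (X : Fin (r + 1 + 1) → Fin r → ℝ) (s : ℕ) (n : ℤ) : ℝ :=
  Real.exp (if h : (1 ≤ s ∧ s ≤ r) ∧ 0 ≤ n ∧ n ≤ r + 1 then
    X ⟨n.toNat, by omega⟩ ⟨r - s, by omega⟩ else 0)

theorem tau_pos {r : ℕ} (X : Fin (r + 1 + 1) → Fin r → ℝ) (s : ℕ) (n : ℤ) : 0 < tau X s n :=
  Real.exp_pos _

theorem tau_zero {r : ℕ} (X : Fin (r + 1 + 1) → Fin r → ℝ) (n : ℤ) : tau X 0 n = 1 := by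
  simp [tau]

theorem tau_apply {r : ℕ} (X : Fin (r + 1 + 1) → Fin r → ℝ) (i : Fin (r + 1 + 1)) (j : Fin r) :
    tau X (r - j) ((i : ℕ) : ℤ) = Real.exp (X i j) := by
  unfold tau
  rw [dif_pos (by omega)]
  congr
  omega

/-- The `m`-integral number `k` of the lattice. -/
noncomputable def mIntegral (r k : ℕ) (X : Fin (r + 1 + 1) → Fin r → ℝ) : ℝ :=
  selfAdjCoeff (tau X) r k

theorem contDiff_tau {r : ℕ} (s : ℕ) (n : ℤ) :
    ContDiff ℝ ∞ fun X : Fin (r + 1 + 1) → Fin r → ℝ => tau X s n := by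
  unfold tau
  by_cases h : (1 ≤ s ∧ s ≤ r) ∧ 0 ≤ n ∧ n ≤ r + 1
  · simp only [dif_pos h]
    fun_prop
  · simp only [dif_neg h]
    fun_prop

theorem contDiff_opCoeff {r : ℕ} (s : ℕ) (i n : ℤ) :
    ContDiff ℝ ∞ fun X : Fin (r + 1 + 1) → Fin r → ℝ => opCoeff (tau X) s i n := by
  induction s generalizing i n with
  | zero => exact contDiff_const
  | succ s ih =>
    simp only [opCoeff, factorCoeff]
    refine (ih _ _).sub (ContDiff.mul (ContDiff.div ?_ ?_ fun X => ?_) (ih _ _))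
    · exact (contDiff_tau _ _).mul (contDiff_tau _ _)
    · exact (contDiff_tau _ _).mul (contDiff_tau _ _)
    · exact (mul_pos (tau_pos _ _ _) (tau_pos _ _ _)).ne'

theorem contDiff_mIntegral (r k : ℕ) : ContDiff ℝ ∞ (mIntegral r k) := by
  unfold mIntegral selfAdjCoeff
  refine ContDiff.sum fun a _ => ((ContDiff.div ?_ ?_ fun X => ?_).mul ?_).mul ?_
  · exact contDiff_tau _ _
  · exact contDiff_tau _ _
  · exact (tau_pos _ _ _).ne'
  · exact contDiff_opCoeff _ _ _
  · exact contDiff_opCoeff _ _ _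

/-- The direction of the unknown `u_{n+i}(j)`. -/
noncomputable def argDir {d r : ℕ} (i : Fin (d + 1)) (j : Fin r) : Fin (d + 1) → Fin r → ℝ :=
  Pi.single i (Pi.single j 1)

theorem tau_add_argDir_of_ne {r : ℕ} (X : Fin (r + 1 + 1) → Fin r → ℝ) (i : Fin (r + 1 + 1))
    (j : Fin r) (t : ℝ) (s : ℕ) (n : ℤ) (h : (s, n) ≠ (r - (j : ℕ), ((i : ℕ) : ℤ))) :
    tau (X + t • argDir i j) s n = tau X s n := by
  unfold tau
  split_ifs with h'
  · congr 1
    by_cases hi : (⟨n.toNat, by omega⟩ : Fin (r + 1 + 1)) = i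
    · have hj : (⟨r - s, by omega⟩ : Fin r) ≠ j := by
        rintro rfl
        subst hi
        apply h
        simp only [Prod.mk.injEq]
        omega
      simp [argDir, hi, hj]
    · simp [argDir, hi]
  · rfl

theorem tau_add_argDir {r : ℕ} (X : Fin (r + 1 + 1) → Fin r → ℝ) (i : Fin (r + 1 + 1))
    (j : Fin r) (t : ℝ) :
    tau (X + t • argDir i j) (r - j) ((i : ℕ) : ℤ) =
      Real.exp t * tau X (r - j) ((i : ℕ) : ℤ) := by
  rw [tau_apply, tau_apply, ← Real.exp_add]
  simp [argDir, add_comm]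

theorem mIntegral_add_last_of_lt {r : ℕ} (X : Fin (r + 1 + 1) → Fin r → ℝ) (k j : Fin r)
    (hjk : j < k) (t : ℝ) :
    mIntegral r k (X + t • argDir (Fin.last (r + 1)) j) = mIntegral r k X := by
  refine selfAdjCoeff_eq_of_top _ _ (tau_pos _) (tau_pos _) (tau_zero _) (tau_zero _) r k (r - j)
    k.2 (by have : (j : ℕ) < k := hjk; omega) fun s n _ h => tau_add_argDir_of_ne _ _ _ _ _ _ ?_
  simpa using h

theorem mIntegral_add_last {r : ℕ} (X : Fin (r + 1 + 1) → Fin r → ℝ) (k : Fin r) (t : ℝ) :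
    mIntegral r k (X + t • argDir (Fin.last (r + 1)) k) = mIntegral r k X +
      (-1) ^ (k : ℕ) * (tau X (r - k) (r + 1) / tau X (r - k) r) * (Real.exp t - 1) := by
  have e := selfAdjCoeff_sub_of_top (tau X)
    (tau (X + t • argDir (Fin.last (r + 1)) k)) (tau_pos _) (tau_pos _)
    (tau_zero _) (tau_zero _) r k k.2 fun s n _ h =>
      tau_add_argDir_of_ne X (Fin.last (r + 1)) k t s n (by simpa using h)
  have e' := tau_add_argDir X (Fin.last (r + 1)) k t
  simp only [Fin.val_last, Nat.cast_add, Nat.cast_one] at e'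
  rw [e'] at e
  unfold mIntegral
  linear_combination e

theorem mIntegral_add_zero_of_gt {r : ℕ} (X : Fin (r + 1 + 1) → Fin r → ℝ) (k j : Fin r)
    (hjk : k < j) (t : ℝ) :
    mIntegral r k (X + t • argDir 0 j) = mIntegral r k X := by
  refine selfAdjCoeff_eq_of_bot _ _ (tau_pos _) (tau_pos _) (tau_zero _) (tau_zero _) r k (r - j)
    k.2 (by have : (k : ℕ) < j := hjk; omega) fun s n _ h => tau_add_argDir_of_ne _ _ _ _ _ _ ?_
  simpa using h

theorem mIntegral_add_zero {r : ℕ} (X : Fin (r + 1 + 1) → Fin r → ℝ) (k : Fin r) (t : ℝ) :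
    mIntegral r k (X + t • argDir 0 k) = mIntegral r k X +
      (-1) ^ (k : ℕ) * (tau X (r - k) 0 / tau X (r - k) 1) * (Real.exp t - 1) := by
  have e := selfAdjCoeff_sub_of_bot (tau X)
    (tau (X + t • argDir 0 k)) (tau_pos _) (tau_pos _)
    r k k.2 fun s n _ h =>
      tau_add_argDir_of_ne X 0 k t s n (by simpa using h)
  have e' := tau_add_argDir X 0 k t
  simp only [Fin.val_zero, Nat.cast_zero] at e'
  rw [e'] at e
  unfold mIntegral
  linear_combination e

/-! ### Orders and leading matrices -/

/-- A function that is affine in `exp t` along a line has the evident directional derivative. -/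
theorem fderiv_apply_eq_of_line {E : Type*} [NormedAddCommGroup E] [NormedSpace ℝ E] {F : E → ℝ}
    {x v : E} {c : ℝ} (hF : DifferentiableAt ℝ F x)
    (h : ∀ t : ℝ, F (x + t • v) = F x + c * (Real.exp t - 1)) : fderiv ℝ F x v = c := by
  have h1 : HasLineDerivAt ℝ F c x v := by
    unfold HasLineDerivAt
    simp only [h]
    simpa using (((Real.hasDerivAt_exp 0).sub_const 1).const_mul c).const_add (F x)
  rw [← hF.lineDeriv_eq_fderiv, h1.lineDeriv]

theorem dependsOnArg_of_line {d r : ℕ} {F : (Fin (d + 1) → Fin r → ℝ) → ℝ} (i : Fin (d + 1))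
    (j : Fin r) {c : ℝ} (hc : c ≠ 0)
    (h : F (0 + (1 : ℝ) • argDir i j) = F 0 + c * (Real.exp 1 - 1)) :
    DependsOnArg F i := by
  refine ⟨0 + (1 : ℝ) • argDir i j, 0, fun k hk => by simp [argDir, hk], ?_⟩
  rw [h]
  have h1 : Real.exp 1 - 1 ≠ 0 := by
    have := Real.add_one_lt_exp (x := 1) one_ne_zero
    linarith
  simpa using ⟨hc, h1⟩

theorem signed_div_tau_ne_zero {r : ℕ} (X : Fin (r + 1 + 1) → Fin r → ℝ) (k s : ℕ) (n n' : ℤ) :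
    (-1) ^ k * (tau X s n / tau X s n') ≠ 0 :=
  mul_ne_zero (pow_ne_zero _ (by norm_num)) (div_pos (tau_pos _ _ _) (tau_pos _ _ _)).ne'

theorem mIntegral_hasOrder {r : ℕ} (k : Fin r) : HasOrder (mIntegral r k) :=
  ⟨dependsOnArg_of_line 0 _ (signed_div_tau_ne_zero 0 _ _ _ _) (mIntegral_add_zero 0 k 1),
    dependsOnArg_of_line _ _ (signed_div_tau_ne_zero 0 _ _ _ _) (mIntegral_add_last 0 k 1)⟩

theorem fderiv_mIntegral_last_of_lt {r : ℕ} (X : Fin (r + 1 + 1) → Fin r → ℝ) (k j : Fin r)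
    (h : j < k) :
    fderiv ℝ (mIntegral r k) X (argDir (Fin.last (r + 1)) j) = 0 :=
  fderiv_apply_eq_of_line ((contDiff_mIntegral r k).differentiable (by simp) X) fun t => by
    rw [mIntegral_add_last_of_lt X k j h]; ring

theorem fderiv_mIntegral_last_ne_zero {r : ℕ} (X : Fin (r + 1 + 1) → Fin r → ℝ) (k : Fin r) :
    fderiv ℝ (mIntegral r k) X (argDir (Fin.last (r + 1)) k) ≠ 0 := by
  rw [fderiv_apply_eq_of_line ((contDiff_mIntegral r k).differentiable (by simp) X)
    (mIntegral_add_last X k)]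
  exact signed_div_tau_ne_zero _ _ _ _ _

theorem fderiv_mIntegral_zero_of_gt {r : ℕ} (X : Fin (r + 1 + 1) → Fin r → ℝ) (k j : Fin r)
    (h : k < j) :
    fderiv ℝ (mIntegral r k) X (argDir 0 j) = 0 :=
  fderiv_apply_eq_of_line ((contDiff_mIntegral r k).differentiable (by simp) X) fun t => by
    rw [mIntegral_add_zero_of_gt X k j h]; ring

theorem fderiv_mIntegral_zero_ne_zero {r : ℕ} (X : Fin (r + 1 + 1) → Fin r → ℝ) (k : Fin r) :
    fderiv ℝ (mIntegral r k) X (argDir 0 k) ≠ 0 := by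
  rw [fderiv_apply_eq_of_line ((contDiff_mIntegral r k).differentiable (by simp) X)
    (mIntegral_add_zero X k)]
  exact signed_div_tau_ne_zero _ _ _ _ _

theorem rank_of_det_ne_zero {r : ℕ} {A : Matrix (Fin r) (Fin r) ℝ} (h : A.det ≠ 0) :
    A.rank = r := by
  rw [Matrix.rank_of_isUnit A ((Matrix.isUnit_iff_isUnit_det A).2 h.isUnit), Fintype.card_fin]

theorem essentiallyIndependent_mIntegral (r : ℕ) :
    EssentiallyIndependent (fun _ : Fin r => r + 1) (fun k => mIntegral r k) := by
  intro x
  apply rank_of_det_ne_zero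
  rw [Matrix.det_of_isUpperTriangular]
  · exact prod_ne_zero_iff.2 fun k _ => fderiv_mIntegral_last_ne_zero _ k
  · intro k j h
    exact fderiv_mIntegral_last_of_lt _ k j h

/-! ### The lattice equations in bilinear form -/

theorem exp_eq_one_add_exp_iff (a b c d e f : ℝ) :
    Real.exp (a + b - c - d) = 1 + Real.exp (e - d - c + f) ↔
      Real.exp a * Real.exp b =
        Real.exp c * Real.exp d + Real.exp e * Real.exp f := by
  have h1 : Real.exp (a + b - c - d) * Real.exp (c + d) = Real.exp a * Real.exp b := by
    rw [← Real.exp_add, ← Real.exp_add]; ring_nf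
  have h2 : (1 + Real.exp (e - d - c + f)) * Real.exp (c + d) =
      Real.exp c * Real.exp d + Real.exp e * Real.exp f := by
    rw [add_mul, one_mul, ← Real.exp_add, ← Real.exp_add, ← Real.exp_add]; ring_nf
  rw [← h1, ← h2, mul_left_inj' (Real.exp_pos _).ne']

theorem tau_eq_exp_cExtend {r : ℕ} (u : ℤ → ℤ → Fin r → ℝ) (n m : ℤ) (i s : ℕ) (hi : i ≤ r + 1)
    (hs : s ≤ r) :
    tau (fun l : Fin (r + 1 + 1) => u (n + (l : ℕ)) m) s i =
      Real.exp (cExtend u (n + i) m ((r - s : ℕ) : ℤ)) := by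
  unfold tau cExtend
  congr 1
  rcases Nat.eq_zero_or_pos s with rfl | hs0
  · rw [dif_neg (by omega), dif_neg (by omega)]
  · rw [dif_pos (by omega), dif_pos (by omega)]
    simp

theorem CSeries.bilinear {r : ℕ} {u : ℤ → ℤ → Fin r → ℝ} {n m : ℤ} {i : ℕ} (hi : i ≤ r)
    (h : CSeries r u (n + i) m) {s : ℕ} (hs : s + 2 ≤ r) :
    Bilinear (tau fun l : Fin (r + 1 + 1) => u (n + (l : ℕ)) m)
      (tau fun l : Fin (r + 1 + 1) => u (n + (l : ℕ)) (m + 1)) s i := by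
  have e := h ⟨r - (s + 1), by omega⟩
  unfold EquationAt at e
  rw [exp_eq_one_add_exp_iff] at e
  have c : (i : ℤ) + 1 = (i + 1 : ℕ) := by push_cast; ring
  unfold Bilinear
  rw [c]
  simp only [tau_eq_exp_cExtend u n _ _ _ (show i ≤ r + 1 by omega) (show s + 1 ≤ r by omega),
    tau_eq_exp_cExtend u n _ _ _ (show i + 1 ≤ r + 1 by omega) (show s + 1 ≤ r by omega),
    tau_eq_exp_cExtend u n _ _ _ (show i ≤ r + 1 by omega) hs,
    tau_eq_exp_cExtend u n _ _ _ (show i + 1 ≤ r + 1 by omega) (show s ≤ r by omega)]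
  have c1 : ((r - (s + 1) : ℕ) : ℤ) - 1 = ((r - (s + 2) : ℕ) : ℤ) := by omega
  have c2 : ((r - (s + 1) : ℕ) : ℤ) + 1 = ((r - s : ℕ) : ℤ) := by omega
  have c3 : n + ((i + 1 : ℕ) : ℤ) = n + i + 1 := by push_cast; ring
  simp only [c1, c2] at e
  rw [c3]
  exact e

theorem CSeries.bilinearBoundary {s : ℕ} {u : ℤ → ℤ → Fin (s + 1) → ℝ} {n m : ℤ} {i : ℕ}
    (hi : i ≤ s + 1) (h : CSeries (s + 1) u (n + i) m) :
    BilinearBoundary (tau fun l : Fin (s + 1 + 1 + 1) => u (n + (l : ℕ)) m)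
      (tau fun l : Fin (s + 1 + 1 + 1) => u (n + (l : ℕ)) (m + 1)) s i := by
  have e := h 0
  unfold EquationAt at e
  rw [exp_eq_one_add_exp_iff] at e
  have c : (i : ℤ) + 1 = (i + 1 : ℕ) := by push_cast; ring
  unfold BilinearBoundary
  rw [c]
  simp only [tau_eq_exp_cExtend u n _ _ _ (show i ≤ s + 1 + 1 by omega) le_rfl,
    tau_eq_exp_cExtend u n _ _ _ (show i + 1 ≤ s + 1 + 1 by omega) le_rfl,
    tau_eq_exp_cExtend u n _ _ _ (show i + 1 ≤ s + 1 + 1 by omega) (show s ≤ s + 1 by omega)]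
  have c3 : n + ((i + 1 : ℕ) : ℤ) = n + i + 1 := by push_cast; ring
  -- The reflection turns `u_{n,m+1}(-1)` into `u_{n+1,m}(1)`.
  have c4 := cExtend_neg u (n + i) (m + 1) 1
  rw [add_sub_cancel_right] at c4
  simp only [Fin.val_zero, Nat.cast_zero, zero_sub, zero_add, c4] at e
  rw [c3, Nat.sub_self, Nat.add_sub_cancel_left, Nat.cast_zero, Nat.cast_one, e]
  ring

theorem mIntegral_invariant {r : ℕ} (k : Fin r) (u : ℤ → ℤ → Fin r → ℝ) (n m : ℤ)
    (h : ∀ i : ℕ, i < r + 1 → CSeries r u (n + i) m) :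
    mIntegral r k (fun i => u (n + (i : ℕ)) (m + 1)) = mIntegral r k fun i => u (n + (i : ℕ)) m := by
  obtain ⟨s, rfl⟩ : ∃ s, r = s + 1 := ⟨r - 1, by have := k.2; omega⟩
  refine selfAdjCoeff_invariant _ _ (tau_pos _) (tau_pos _) (tau_zero _) (tau_zero _) s k
    (by have := k.2; omega) (fun t ht i h1 h2 => ?_) (fun i h1 h2 => ?_)
  all_goals obtain ⟨i, rfl⟩ := Int.eq_ofNat_of_zero_le h1
  · exact CSeries.bilinear (by omega) (h i (by omega)) (by omega)
  · exact CSeries.bilinearBoundary (by omega) (h i (by omega))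

theorem mIntegral_isMIntegral {r : ℕ} (k : Fin r) :
    IsMIntegral (CSeries r) (r + 1) (mIntegral r k) :=
  ⟨contDiff_mIntegral r k, mIntegral_hasOrder k, fun u n m h => mIntegral_invariant k u n m h⟩

/-! ### The symmetry between the two directions -/

/-- The lattice is invariant under `(n, m) ↦ (-m, -n)`, which interchanges the two directions and
is compatible with the reflection `u_{n,m}(-j) = u_{n+j,m-j}(j)`. -/
theorem cSeries_swap {r : ℕ} (u : ℤ → ℤ → Fin r → ℝ) (n m : ℤ) :
    CSeries r (fun a b => u (-b) (-a)) n m ↔ CSeries r u (-(m + 1)) (-(n + 1)) := by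
  have hc : ∀ a b j : ℤ, cExtend (fun a b => u (-b) (-a)) a b j = cExtend u (-b) (-a) j := by
    intro a b j
    unfold cExtend
    have h1 : -(b - max (-j) 0) = -b + max (-j) 0 := by ring
    have h2 : -(a + max (-j) 0) = -a - max (-j) 0 := by ring
    simp only [h1, h2]
  unfold CSeries EquationAt
  have h1 : -(m + 1) + 1 = -m := by ring
  have h2 : -(n + 1) + 1 = -n := by ring
  simp only [hc, h1, h2]
  refine forall_congr' fun j => ?_
  rw [add_comm (cExtend u (-(m + 1)) (-(n + 1)) _)]

/-- The `n`-integral number `k` of the lattice: the `m`-integral with reversed arguments. -/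
noncomputable def nIntegral (r k : ℕ) (X : Fin (r + 1 + 1) → Fin r → ℝ) : ℝ :=
  mIntegral r k fun i => X i.rev

/-- Reversal of the order of the arguments, as a linear map. -/
noncomputable def revArgs (r : ℕ) :
    (Fin (r + 1 + 1) → Fin r → ℝ) →L[ℝ] (Fin (r + 1 + 1) → Fin r → ℝ) :=
  ContinuousLinearMap.pi fun i => ContinuousLinearMap.proj i.rev

theorem revArgs_single {r : ℕ} (i : Fin (r + 1 + 1)) (v : Fin r → ℝ) :
    revArgs r (Pi.single i v) = Pi.single i.rev v := by
  ext l : 1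
  change (Pi.single i v : Fin (r + 1 + 1) → Fin r → ℝ) l.rev = _
  by_cases h : l = i.rev
  · subst h
    simp
  · have h' : l.rev ≠ i := fun e => h (by rw [← e, Fin.rev_rev])
    simp [h, h']

theorem nIntegral_eq_comp (r k : ℕ) : nIntegral r k = mIntegral r k ∘ revArgs r := rfl

theorem fderiv_nIntegral_last {r : ℕ} (k : ℕ) (X : Fin (r + 1 + 1) → Fin r → ℝ) (v : Fin r → ℝ) :
    fderiv ℝ (nIntegral r k) X (Pi.single (Fin.last (r + 1)) v) =
      fderiv ℝ (mIntegral r k) (revArgs r X) (Pi.single 0 v) := by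
  rw [nIntegral_eq_comp, fderiv_comp X
    ((contDiff_mIntegral r k).differentiable (by simp) _) (revArgs r).differentiableAt,
    ContinuousLinearMap.fderiv, ContinuousLinearMap.comp_apply, revArgs_single, Fin.rev_last]

theorem DependsOnArg.comp_rev {d r : ℕ} {F : (Fin (d + 1) → Fin r → ℝ) → ℝ} {i : Fin (d + 1)}
    (h : DependsOnArg F i) : DependsOnArg (fun X => F fun l => X l.rev) i.rev := by
  obtain ⟨x, y, hxy, hF⟩ := h
  refine ⟨fun l => x l.rev, fun l => y l.rev, fun l hl => hxy _ fun e => hl ?_, ?_⟩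
  · rw [← e, Fin.rev_rev]
  · simpa using hF

theorem nIntegral_hasOrder {r : ℕ} (k : Fin r) : HasOrder (nIntegral r k) := by
  obtain ⟨h1, h2⟩ := mIntegral_hasOrder k
  refine ⟨?_, ?_⟩
  · have e : DependsOnArg (nIntegral r k) _ := h2.comp_rev
    rwa [Fin.rev_last] at e
  · have e : DependsOnArg (nIntegral r k) _ := h1.comp_rev
    rwa [Fin.rev_zero] at e

theorem nIntegral_invariant {r : ℕ} (k : Fin r) (u : ℤ → ℤ → Fin r → ℝ) (n m : ℤ)
    (h : ∀ i : ℕ, i < r + 1 → CSeries r u n (m + i)) :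
    nIntegral r k (fun i => u (n + 1) (m + (i : ℕ))) = nIntegral r k fun i => u n (m + (i : ℕ)) := by
  have e := mIntegral_invariant k (fun a b => u (-b) (-a)) (-(m + (r + 1))) (-(n + 1))
    fun i hi => by
      rw [cSeries_swap]
      have := h (r - i) (by omega)
      convert this using 1
      · ring
      · omega
  unfold nIntegral
  have c : ∀ i : Fin (r + 1 + 1),
      -(-(m + ((r : ℤ) + 1)) + ((i : ℕ) : ℤ)) = m + ((i.rev : ℕ) : ℤ) := by
    intro i
    rw [Fin.val_rev]
    omega
  have c1 : -(-(n + 1) + 1) = n := by ring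
  simp only [c, c1, neg_neg] at e
  exact e.symm

theorem nIntegral_isNIntegral {r : ℕ} (k : Fin r) :
    IsNIntegral (CSeries r) (r + 1) (nIntegral r k) :=
  ⟨(contDiff_mIntegral r k).comp (revArgs r).contDiff, nIntegral_hasOrder k,
    fun u n m h => nIntegral_invariant k u n m h⟩

theorem essentiallyIndependent_nIntegral (r : ℕ) :
    EssentiallyIndependent (fun _ : Fin r => r + 1) (fun k => nIntegral r k) := by
  intro x
  apply rank_of_det_ne_zero
  rw [Matrix.det_of_isLowerTriangular]
  · refine prod_ne_zero_iff.2 fun k _ => ?_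
    rw [leadingMatrix, Matrix.of_apply, fderiv_nIntegral_last]
    exact fderiv_mIntegral_zero_ne_zero _ k
  · intro k j h
    rw [leadingMatrix, Matrix.of_apply, fderiv_nIntegral_last]
    exact fderiv_mIntegral_zero_of_gt _ k j h

end Toda

theorem mainTheorem3 (r : ℕ) (hr : 1 ≤ r) : Toda.DarbouxIntegrable (Toda.CSeries r) :=
  ⟨⟨fun _ => r + 1, fun k => Toda.nIntegral r k, Toda.nIntegral_isNIntegral,
      Toda.essentiallyIndependent_nIntegral r⟩,
    ⟨fun _ => r + 1, fun k => Toda.mIntegral r k, Toda.mIntegral_isMIntegral,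
      Toda.essentiallyIndependent_mIntegral r⟩⟩
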